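/- Consider UAVs hovering at altitude $h>0$. A typical UAV $u_0$ is located above the origin of the plane, and the ground projections of the other (interfering) UAVs, $\Phi\setminus u_0$, form a homogeneous Poisson point process on $\mathbb{R}^2$ with intensity $\lambda>0$. Fix a receiver at a point $y\in\mathbb{R}^2$ on the ground (for instance $y=0$). Given the locations, the links from the interfering UAVs $u$ to the receiver are independent, and with $q_u=\|u-y\|$ each of them is described as follows. The link is line-of-sight ($z_u=L$) with probability $$P_L(q_u),\qquad P_L(q)=\frac{1}{1+a\exp\left(-b\left[\frac{180}{\pi}\arctan(h/q)-a\right]\right)},$$ and non-line-of-sight ($z_u=N$) with probability $P_N(q_u)=1-P_L(q_u)$, where $a\ge 0$ and $b\in\mathbb{R}$ are constants. Its antenna gain $G_u$ equals $G_i$ with probability $p_i$, $i=1,\dots,4$, where $$(G_1,G_2,G_3,G_4)=(M_uM_d,\;M_um_d,\;m_uM_d,\;m_um_d),$$ $$(p_1,p_2,p_3,p_4)=\big(t_ut_d,\;t_u(1-t_d),\;(1-t_u)t_d,\;(1-t_u)(1-t_d)\big),\qquad t_u=\tfrac{\theta_u}{2\pi},\quad t_d=\tfrac{\theta_d}{2\pi},$$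 with $M_u,m_u,M_d,m_d\ge 0$ the main and side lobe gains of the UAV and device antennas and $\theta_u,\theta_d\in[0,2\pi]$ their main lobe beamwidths. Given $z_u=z$, its fading power $|h_u|_z^2$ is independent of $G_u$ and has the Gamma distribution with shape $m_z$ and rate $m_z$ (mean one; power of normalized Nakagami-$m_z$ fading), $m_z>0$. Let $P_u>0$ be the transmission power of a UAV and $\alpha_L,\alpha_N>2$ the path-loss exponents, and let $$I_{\mathrm{DL}}=\sum_{u\in\Phi\setminus u_0}P_u\,G_u\,|h_u|_{z_u}^2\,(q_u^2+h^2)^{-\alpha_{z_u}/2}$$ be the downlink interference. Then $I_{\mathrm{DL}}<\infty$ almost surely, and for every real $s\ge 0$ its Laplace transform $\mathcal{L}_{\mathrm{DL}}(s)=\mathbb{E}\left[e^{-sI_{\mathrm{DL}}}\right]$ is $$\mathcal{L}_{\mathrm{DL}}(s)=\prod_{z\in\{L,N\}}\exp\left(-2\pi\lambda\int_0^\infty\left[1-\sum_{i=1}^4p_i\left(1+\frac{sP_uG_i(q^2+h^2)^{-\alpha_z/2}}{m_z}\right)^{-m_z}\right]q\,P_z(q)\,dq\right),$$ where both integrals converge.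 -/

import Mathlib

open MeasureTheory ProbabilityTheory
open scoped ENNReal

noncomputable section

/-- The ground plane, with its Euclidean norm. -/
abbrev Plane : Type := EuclideanSpace ℝ (Fin 2)

/-- Type of a link: line-of-sight or non-line-of-sight. -/
inductive LinkType where
  | los : LinkType
  | nlos : LinkType
  deriving DecidableEq

instance : Fintype LinkType :=
  ⟨{LinkType.los, LinkType.nlos}, fun z => by cases z <;> simp⟩

instance : MeasurableSpace LinkType := ⊤

/-- The parameters of the network (antenna gains on a linear scale, not in dB). -/
structure NetworkParams where
  /-- intensity of the UAV process (UAVs per unit area) -/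
  lam : ℝ
  /-- altitude of the UAVs -/
  h : ℝ
  /-- transmission power of a UAV -/
  Pu : ℝ
  /-- environment constants of the line-of-sight probability -/
  a : ℝ
  b : ℝ
  /-- path-loss exponents and Nakagami parameters of the two link types -/
  α : LinkType → ℝ
  m : LinkType → ℝ
  /-- main lobe gain, side lobe gain and main lobe beamwidth of the UAV antennas -/
  mainU : ℝ
  sideU : ℝ
  θU : ℝ
  /-- main lobe gain, side lobe gain and main lobe beamwidth of the device antennas -/
  mainD : ℝ
  sideD : ℝ
  θD : ℝ
  lam_pos : 0 < lam
  h_pos : 0 < h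
  Pu_pos : 0 < Pu
  a_nonneg : 0 ≤ a
  α_gt_two : ∀ z, 2 < α z
  m_pos : ∀ z, 0 < m z
  mainU_nonneg : 0 ≤ mainU
  sideU_nonneg : 0 ≤ sideU
  mainD_nonneg : 0 ≤ mainD
  sideD_nonneg : 0 ≤ sideD
  θU_mem : θU ∈ Set.Icc 0 (2 * Real.pi)
  θD_mem : θD ∈ Set.Icc 0 (2 * Real.pi)

namespace NetworkParams

variable (P : NetworkParams)

/-- Probability `P_L(q)` that a link of horizontal length `q` is line-of-sight. (Only `q > 0`
matters: a Poisson process almost surely has no point at a given location.) -/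
def losProb (q : ℝ) : ℝ :=
  1 / (1 + P.a * Real.exp (-(P.b * (180 / Real.pi * Real.arctan (P.h / q) - P.a))))

/-- Probability `P_z(q)` that a link of horizontal length `q` is of type `z`. -/
def linkProb : LinkType → ℝ → ℝ
  | LinkType.los, q => P.losProb q
  | LinkType.nlos, q => 1 - P.losProb q

/-- The gains `G_i` of the four antenna patterns. -/
def gain : Fin 4 → ℝ :=
  ![P.mainU * P.mainD, P.mainU * P.sideD, P.sideU * P.mainD, P.sideU * P.sideD]

/-- The probabilities `p_i` of the four antenna patterns. -/
def gainProb : Fin 4 → ℝ :=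
  ![(P.θU / (2 * Real.pi)) * (P.θD / (2 * Real.pi)),
    (P.θU / (2 * Real.pi)) * (1 - P.θD / (2 * Real.pi)),
    (1 - P.θU / (2 * Real.pi)) * (P.θD / (2 * Real.pi)),
    (1 - P.θU / (2 * Real.pi)) * (1 - P.θD / (2 * Real.pi))]

/-- The law of the directionality gain of an interfering link: `G_i` with probability `p_i`. -/
def gainLaw : Measure ℝ :=
  ∑ i, ENNReal.ofReal (P.gainProb i) • Measure.dirac (P.gain i)

/-- The law of the power `|h|²` of normalized Nakagami fading on a link of type `z`: the Gamma
distribution with shape `m_z` and rate `m_z`, hence with mean one. -/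
def fadingLaw (z : LinkType) : Measure ℝ :=
  gammaMeasure (P.m z) (P.m z)

/-- The joint law of (link type, directionality gain, fading power) of a link of horizontal length
`q`: the type is `z` with probability `P_z(q)`; given the type, gain and fading are independent. -/
def markLaw (q : ℝ) : Measure (LinkType × ℝ × ℝ) :=
  ∑ z, ENNReal.ofReal (P.linkProb z q) •
    (Measure.dirac z).prod (P.gainLaw.prod (P.fadingLaw z))

end NetworkParams

/-- Number of points of the sequence `U 0 ω, U 1 ω, …` in `B`, counted with multiplicity. -/
def pointCount {Ω : Type*} (U : ℕ → Ω → Plane) (B : Set Plane) (ω : Ω) : ℝ≥0∞ :=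
  ∑' n, B.indicator (fun _ => (1 : ℝ≥0∞)) (U n ω)

/-- `U` enumerates a homogeneous Poisson point process of intensity `lam > 0` on the plane: the
number of points in a set of finite area is Poisson with mean `lam` times the area, and the
numbers of points in disjoint sets are independent. (For `lam > 0` there are almost surely
infinitely many points, so they can be enumerated by `ℕ`.) -/
structure IsHomogeneousPPP {Ω : Type*} [MeasurableSpace Ω] (μ : Measure Ω) (lam : ℝ)
    (U : ℕ → Ω → Plane) : Prop where
  measurable : ∀ n, Measurable (U n)
  count_law : ∀ B : Set Plane, MeasurableSet B → volume B ≠ ∞ →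
    HasLaw (pointCount U B)
      ((poissonMeasure (lam.toNNReal * (volume B).toNNReal)).map (Nat.cast : ℕ → ℝ≥0∞)) μ
  indep : ∀ (k : ℕ) (B : Fin k → Set Plane), (∀ i, MeasurableSet (B i)) →
    Pairwise (fun i j => Disjoint (B i) (B j)) →
    iIndepFun (fun i => pointCount U (B i)) μ

/-- The interfering UAVs and their links to a receiver at `y` on the ground. `U n` is the
projection of the `n`-th interfering UAV; `Z n`, `G n`, `H n` are the type, the directionality gain
and the fading power of its link. The locations form a homogeneous Poisson point process and,
given all locations, the triples `(Z n, G n, H n)` are independent, the `n`-th one having the law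
`markLaw ‖U n - y‖`. -/
structure IsInterferenceField {Ω : Type*} [MeasurableSpace Ω] (μ : Measure Ω)
    (P : NetworkParams) (y : Plane) (U : ℕ → Ω → Plane) (Z : ℕ → Ω → LinkType)
    (G H : ℕ → Ω → ℝ) : Prop where
  poisson : IsHomogeneousPPP μ P.lam U
  measurable_type : ∀ n, Measurable (Z n)
  measurable_gain : ∀ n, Measurable (G n)
  measurable_fading : ∀ n, Measurable (H n)
  marks : ∀ (A : Set (ℕ → Plane)), MeasurableSet A →
    ∀ (k : ℕ) (B : ℕ → Set (LinkType × ℝ × ℝ)), (∀ n, MeasurableSet (B n)) →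
    μ {ω | (fun n => U n ω) ∈ A ∧ ∀ n < k, (Z n ω, G n ω, H n ω) ∈ B n} =
      ∫⁻ ω in {ω | (fun n => U n ω) ∈ A},
        ∏ n ∈ Finset.range k, P.markLaw ‖U n ω - y‖ (B n) ∂μ

/-- Power received at `y` from the `n`-th interfering UAV. -/
def receivedPower {Ω : Type*} (P : NetworkParams) (y : Plane) (U : ℕ → Ω → Plane)
    (Z : ℕ → Ω → LinkType) (G H : ℕ → Ω → ℝ) (n : ℕ) (ω : Ω) : ℝ :=
  P.Pu * G n ω * H n ω * (‖U n ω - y‖ ^ 2 + P.h ^ 2) ^ (-(P.α (Z n ω)) / 2)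

/-- The downlink interference at `y`. -/
def downlinkInterference {Ω : Type*} (P : NetworkParams) (y : Plane) (U : ℕ → Ω → Plane)
    (Z : ℕ → Ω → LinkType) (G H : ℕ → Ω → ℝ) (ω : Ω) : ℝ :=
  ∑' n, receivedPower P y U Z G H n ω

/-- The Laplace transform `s ↦ E[exp(-s X)]` of a random variable. -/
def laplaceTransform {Ω : Type*} [MeasurableSpace Ω] (μ : Measure Ω) (X : Ω → ℝ) (s : ℝ) : ℝ :=
  ∫ ω, Real.exp (-s * X ω) ∂μ

end

/-! Given the locations, the marks are independent, so averaging `exp (-s I)` over them leaves the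
product of `φ (U n)`. Here `φ x`, the Laplace transform of the power received from a UAV at `x`, is
the mixture over link types of `powerTransform`; the Gamma law supplies its factors `(1 +
c/m)^(-m)`. With `g = -log φ` this product is `exp (-∑ g (U n))`, and the Laplace functional of the
Poisson process turns its mean into `exp (-λ ∫ (1 - φ))`. As the type probabilities sum to one, `1 -
φ` splits into one term per type; translation invariance removes `y` and polar coordinates give the
radial integrals.

All convergence rests on the mean power, which is integrable over the plane because the path-loss
exponents exceed its dimension. Campbell's formula then makes the interference summable almost
surely. Jensen's inequality bounds each transform below by `exp (-s · mean)`, so that `φ > 0`, and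
both `-log φ` and `1 - φ` are at most `s · mean`.

The main steps are `laplace_functional` (from simple functions by monotone approximation),
`lintegral_prod_marks` (finitely many marks at a time) and `laplaceTransform_eq_integral`, which
joins them by a limit of partial sums. -/

/-! ### Laplace transform and mean of the Poisson distribution -/

theorem integral_exp_neg_mul_poissonMeasure (r : NNReal) (c : ℝ) :
    ∫ n : ℕ, Real.exp (-(c * n)) ∂(poissonMeasure r) = Real.exp (-(r * (1 - Real.exp (-c)))) := by
  rw [integral_poissonMeasure]
  have h : HasSum (fun n : ℕ => Real.exp (-r) * ((r * Real.exp (-c)) ^ n / (n.factorial : ℝ)))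
      (Real.exp (-r) * Real.exp (r * Real.exp (-c))) := by
    have := (NormedSpace.expSeries_div_hasSum_exp ((r : ℝ) * Real.exp (-c))).mul_left
      (Real.exp (-r))
    rwa [← Real.exp_eq_exp_ℝ] at this
  rw [← Real.exp_add] at h
  convert h.tsum_eq using 1
  · congr 1 with n
    rw [mul_pow, ← Real.exp_nat_mul, smul_eq_mul]
    ring_nf
  · ring_nf

theorem lintegral_natCast_poissonMeasure (r : NNReal) :
    ∫⁻ n : ℕ, (n : ℝ≥0∞) ∂(poissonMeasure r) = r := by
  simp only [poissonMeasure, lintegral_sum_measure, lintegral_smul_measure, lintegral_dirac,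
    smul_eq_mul]
  -- The term `n = 0` vanishes; in the others `(n+1)/(n+1)! = 1/n!` leaves `r` times the Poisson
  -- weights.
  rw [tsum_eq_zero_add' ENNReal.summable]
  simp only [Nat.cast_zero, mul_zero, zero_add]
  have h : ∀ n : ℕ, ENNReal.ofReal (Real.exp (-r) * r ^ (n + 1) / ((n + 1).factorial : ℝ)) *
      ((n + 1 : ℕ) : ℝ≥0∞) = r * ENNReal.ofReal (Real.exp (-r) * r ^ n / (n.factorial : ℝ)) := by
    intro n
    rw [← ENNReal.ofReal_coe_nnreal, ← ENNReal.ofReal_natCast,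
      ← ENNReal.ofReal_mul (by positivity), ← ENNReal.ofReal_mul (by positivity)]
    congr 1
    rw [Nat.factorial_succ]
    push_cast
    field_simp
    ring
  simp_rw [h]
  rw [ENNReal.tsum_mul_left, ← ENNReal.ofReal_tsum_of_nonneg (fun n => by positivity)
    (hasSum_one_poissonMeasure r).summable, (hasSum_one_poissonMeasure r).tsum_eq]
  simp

/-! ### Campbell's formula and the Laplace functional of the Poisson process -/

namespace IsHomogeneousPPP

variable {Ω : Type*} [MeasurableSpace Ω] {μ : Measure Ω} {lam : ℝ} {U : ℕ → Ω → Plane}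

theorem measurable_pointCount (hU : IsHomogeneousPPP μ lam U) {B : Set Plane}
    (hB : MeasurableSet B) : Measurable (pointCount U B) :=
  Measurable.tsum fun n => (measurable_const.indicator hB).comp (hU.measurable n)

theorem lintegral_pointCount (hU : IsHomogeneousPPP μ lam U) {B : Set Plane}
    (hB : MeasurableSet B) (hfin : volume B ≠ ∞) :
    ∫⁻ ω, pointCount U B ω ∂μ = ENNReal.ofReal lam * volume B := by
  have h := (hU.count_law B hB hfin).lintegral_comp (f := fun x => x) aemeasurable_id
  rw [h, lintegral_map (f := fun x : ℝ≥0∞ => x) measurable_id (by fun_prop),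
    lintegral_natCast_poissonMeasure]
  rw [ENNReal.coe_mul, ENNReal.coe_toNNReal hfin]
  rfl

/-- Campbell's formula. -/
theorem lintegral_tsum (hU : IsHomogeneousPPP μ lam U) {g : Plane → ℝ≥0∞} (hg : Measurable g) :
    ∫⁻ ω, ∑' n, g (U n ω) ∂μ = ENNReal.ofReal lam * ∫⁻ x, g x := by
  -- The intensity measure is `lam` times the area. The count law covers only sets of finite area;
  -- these form a generating π-system, and balls exhaust the plane.
  have key : Measure.sum (fun n => μ.map (U n)) = ENNReal.ofReal lam • (volume : Measure Plane) := by
    have hset : ∀ B, MeasurableSet B → volume B ≠ ∞ →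
        Measure.sum (fun n => μ.map (U n)) B = ENNReal.ofReal lam * volume B := by
      intro B hB hfin
      rw [← hU.lintegral_pointCount hB hfin, Measure.sum_apply _ hB]
      unfold pointCount
      rw [MeasureTheory.lintegral_tsum (f := fun n ω => B.indicator (fun _ => 1) (U n ω)) fun n =>
        ((measurable_const.indicator hB).comp (hU.measurable n)).aemeasurable]
      congr 1 with n
      rw [Measure.map_apply (hU.measurable n) hB, ← lintegral_indicator_one
        (hU.measurable n hB)]
      rfl
    refine Measure.ext_of_generateFrom_of_iUnion {B | MeasurableSet B ∧ volume B ≠ ∞}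
      (fun n => Metric.ball 0 n) ?_ ?_ (Metric.iUnion_ball_nat 0) ?_ ?_ ?_
    · refine le_antisymm ?_ (MeasurableSpace.generateFrom_le fun B hB => hB.1)
      intro B hB
      have : B = ⋃ n : ℕ, B ∩ Metric.ball 0 n := by
        rw [← Set.inter_iUnion, Metric.iUnion_ball_nat, Set.inter_univ]
      rw [this]
      refine MeasurableSet.iUnion fun n => MeasurableSpace.measurableSet_generateFrom
        ⟨hB.inter measurableSet_ball, ?_⟩
      exact ne_top_of_le_ne_top measure_ball_lt_top.ne (measure_mono Set.inter_subset_right)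
    · rintro B ⟨hB, hfin⟩ C ⟨hC, -⟩ -
      exact ⟨hB.inter hC, ne_top_of_le_ne_top hfin (measure_mono Set.inter_subset_left)⟩
    · exact fun n => ⟨measurableSet_ball, measure_ball_lt_top.ne⟩
    · intro n
      rw [hset _ measurableSet_ball measure_ball_lt_top.ne]
      exact ENNReal.mul_ne_top ENNReal.ofReal_ne_top measure_ball_lt_top.ne
    · rintro B ⟨hB, hfin⟩
      rw [hset B hB hfin]
      rfl
  calc ∫⁻ ω, ∑' n, g (U n ω) ∂μ = ∑' n, ∫⁻ ω, g (U n ω) ∂μ :=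
        MeasureTheory.lintegral_tsum fun n => (hg.comp (hU.measurable n)).aemeasurable
    _ = ∫⁻ x, g x ∂(Measure.sum fun n => μ.map (U n)) := by
        rw [lintegral_sum_measure]
        congr 1 with n
        rw [lintegral_map hg (hU.measurable n)]
    _ = _ := by rw [key, lintegral_smul_measure, smul_eq_mul]

theorem ae_tsum_ne_top (hU : IsHomogeneousPPP μ lam U) {g : Plane → ℝ≥0∞} (hg : Measurable g)
    (hint : ∫⁻ x, g x ≠ ∞) : ∀ᵐ ω ∂μ, ∑' n, g (U n ω) ≠ ∞ := by
  have h := ae_lt_top (μ := μ) (f := fun ω => ∑' n, g (U n ω))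
    (Measurable.tsum fun n => hg.comp (hU.measurable n))
    (by rw [hU.lintegral_tsum hg]; exact ENNReal.mul_ne_top ENNReal.ofReal_ne_top hint)
  exact h.mono fun ω hω => hω.ne

theorem integral_exp_neg_mul_pointCount (hU : IsHomogeneousPPP μ lam U) (hlam : 0 ≤ lam)
    {B : Set Plane} (hB : MeasurableSet B) (hfin : volume B ≠ ∞) (c : ℝ) :
    ∫ ω, Real.exp (-(c * (pointCount U B ω).toReal)) ∂μ =
      Real.exp (-(lam * ((1 - Real.exp (-c)) * volume.real B))) := by
  have hm : Measurable fun x : ℝ≥0∞ => Real.exp (-(c * x.toReal)) := by fun_prop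
  have h := (hU.count_law B hB hfin).integral_comp (f := fun x => Real.exp (-(c * x.toReal)))
    hm.aestronglyMeasurable
  rw [Function.comp_def] at h
  rw [h, integral_map (by fun_prop) hm.aestronglyMeasurable]
  simp only [ENNReal.toReal_natCast]
  rw [integral_exp_neg_mul_poissonMeasure]
  congr 2
  rw [NNReal.coe_mul, Real.coe_toNNReal _ hlam, Measure.real]
  simp only [ENNReal.toReal]
  ring

/-- The Laplace functional of a simple function. -/
theorem laplace_simpleFunc (hU : IsHomogeneousPPP μ lam U) (hlam : 0 ≤ lam)
    (g : SimpleFunc Plane ℝ≥0∞) (hint : ∫⁻ x, g x ≠ ∞) (hfin : ∀ x, g x ≠ ∞) :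
    ∫ ω, Real.exp (-(∑' n, g (U n ω)).toReal) ∂μ =
      Real.exp (-(lam * ∫ x, (1 - Real.exp (-(g x).toReal)))) := by
  classical
  -- The value `0` is left out: it contributes nothing, and its fibre has infinite area.
  set R : Finset ℝ≥0∞ := g.range.filter (· ≠ 0) with hR
  have hR0 : ∀ c ∈ R, c ≠ 0 := fun c hc => (Finset.mem_filter.1 hc).2
  have hRtop : ∀ c ∈ R, c ≠ ∞ := by
    intro c hc
    obtain ⟨x, rfl⟩ := SimpleFunc.mem_range.1 (Finset.mem_filter.1 hc).1
    exact hfin x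
  have hmeas : ∀ c, MeasurableSet (g ⁻¹' {c}) := fun c => g.measurableSet_fiber c
  -- Markov's inequality, since `g` has finite integral.
  have hvol : ∀ c ∈ R, volume (g ⁻¹' {c}) ≠ ∞ := by
    intro c hc
    have hle := mul_meas_ge_le_lintegral (μ := (volume : Measure Plane)) g.measurable c
    have hne := ne_top_of_le_ne_top hint hle
    have : volume {x | c ≤ g x} ≠ ∞ := fun h => hne (by rw [h, ENNReal.mul_top (hR0 c hc)])
    exact ne_top_of_le_ne_top this (measure_mono fun x hx => (Set.mem_singleton_iff.1 hx).ge)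
  have hdecomp : ∀ {M : Type} [AddCommMonoid M] (F : ℝ≥0∞ → M) (_ : F 0 = 0) (x : Plane),
      F (g x) = ∑ c ∈ R, (g ⁻¹' {c}).indicator (fun _ => F c) x := by
    intro M _ F hF x
    simp only [Set.indicator_apply, Set.mem_preimage, Set.mem_singleton_iff]
    rw [Finset.sum_ite_eq]
    split_ifs with h
    · rfl
    · have : g x = 0 := by
        by_contra h0
        exact h (Finset.mem_filter.2 ⟨SimpleFunc.mem_range_self g x, h0⟩)
      rw [this, hF]
  have hsum : ∀ ω, ∑' n, g (U n ω) = ∑ c ∈ R, c * pointCount U (g ⁻¹' {c}) ω := by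
    intro ω
    simp_rw [hdecomp (fun c => c) rfl]
    rw [Summable.tsum_finsetSum fun c _ => ENNReal.summable]
    refine Finset.sum_congr rfl fun c _ => ?_
    rw [pointCount, ← ENNReal.tsum_mul_left]
    congr 1 with n
    simp [Set.indicator_apply]
  have hNfin : ∀ᵐ ω ∂μ, ∀ c ∈ R, pointCount U (g ⁻¹' {c}) ω ≠ ∞ := by
    rw [Filter.eventually_all_finset]
    intro c hc
    refine hU.ae_tsum_ne_top (measurable_const.indicator (hmeas c)) ?_
    rw [lintegral_indicator (hmeas c)]
    simpa using hvol c hc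
  have hindep : iIndepFun (fun c : R => pointCount U (g ⁻¹' {(c : ℝ≥0∞)})) μ := by
    let e := R.equivFin
    have h := hU.indep R.card (fun i => g ⁻¹' {((e.symm i : R) : ℝ≥0∞)}) (fun i => hmeas _) ?_
    · have := h.precomp (g := e) e.injective
      simpa [Function.comp_def] using this
    · intro i j hij
      refine Set.disjoint_left.2 fun x hx hx' => hij ?_
      have : ((e.symm i : R) : ℝ≥0∞) = (e.symm j : R) := by
        rw [← Set.mem_singleton_iff.1 hx, ← Set.mem_singleton_iff.1 hx']
      exact e.symm.injective (Subtype.ext this)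
  -- Where the counts are finite, the sum over points is a finite linear combination of counts in
  -- disjoint fibres, so its exponential is a product of independent factors.
  have hprod : ∀ᵐ ω ∂μ, Real.exp (-(∑' n, g (U n ω)).toReal) =
      ∏ c : R, Real.exp (-((c : ℝ≥0∞).toReal * (pointCount U (g ⁻¹' {(c : ℝ≥0∞)}) ω).toReal)) := by
    filter_upwards [hNfin] with ω hω
    rw [hsum, ENNReal.toReal_sum fun c hc => ENNReal.mul_ne_top (hRtop c hc) (hω c hc),
      ← Finset.sum_neg_distrib, Real.exp_sum, ← Finset.prod_coe_sort]
    simp only [ENNReal.toReal_mul]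
  rw [integral_congr_ae hprod]
  have hcomp := hindep.integral_fun_prod_comp
    (f := fun (c : R) x => Real.exp (-((c : ℝ≥0∞).toReal * x.toReal)))
    (fun c => (hU.measurable_pointCount (hmeas c)).aemeasurable)
    (fun c => (by fun_prop : Measurable fun x : ℝ≥0∞ =>
      Real.exp (-((c : ℝ≥0∞).toReal * x.toReal))).aestronglyMeasurable)
  rw [hcomp]
  have hone : ∀ c : R, ∫ ω, Real.exp (-((c : ℝ≥0∞).toReal *
      (pointCount U (g ⁻¹' {(c : ℝ≥0∞)}) ω).toReal)) ∂μ = _ := fun c =>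
    hU.integral_exp_neg_mul_pointCount hlam (hmeas c) (hvol c c.2) _
  simp_rw [hone]
  rw [← Real.exp_sum]
  congr 1
  rw [Finset.sum_neg_distrib, ← Finset.mul_sum]
  congr 2
  have hg : ∀ x, 1 - Real.exp (-(g x).toReal) =
      ∑ c ∈ R, (g ⁻¹' {c}).indicator (fun _ => 1 - Real.exp (-c.toReal)) x :=
    hdecomp (fun c => 1 - Real.exp (-c.toReal)) (by simp)
  simp_rw [hg]
  rw [integral_finsetSum, ← Finset.sum_coe_sort R fun c =>
    ∫ x, (g ⁻¹' {c}).indicator (fun _ => 1 - Real.exp (-c.toReal)) x]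
  · refine Finset.sum_congr rfl fun c _ => ?_
    rw [integral_indicator (hmeas _), setIntegral_const, smul_eq_mul, mul_comm]
  · intro c hc
    rw [integrable_indicator_iff (hmeas c)]
    exact integrableOn_const (hvol c hc)

/-- The Laplace functional of a homogeneous Poisson point process. -/
theorem laplace_functional (hU : IsHomogeneousPPP μ lam U) [IsProbabilityMeasure μ]
    (hlam : 0 ≤ lam) {g : Plane → ℝ≥0∞} (hg : Measurable g) (hint : ∫⁻ x, g x ≠ ∞)
    (hfin : ∀ x, g x ≠ ∞) :
    ∫ ω, Real.exp (-(∑' n, g (U n ω)).toReal) ∂μ =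
      Real.exp (-(lam * ∫ x, (1 - Real.exp (-(g x).toReal)))) := by
  have hmono := SimpleFunc.monotone_eapprox g
  have hlim : ∀ x, Filter.Tendsto (fun k => SimpleFunc.eapprox g k x) Filter.atTop (nhds (g x)) :=
    fun x => SimpleFunc.tendsto_eapprox hg x
  have hle : ∀ k x, SimpleFunc.eapprox g k x ≤ g x := by
    intro k x
    rw [← SimpleFunc.iSup_eapprox_apply hg x]
    exact le_iSup (fun k => SimpleFunc.eapprox g k x) k
  have hsimple : ∀ k, _ := fun k => hU.laplace_simpleFunc hlam (SimpleFunc.eapprox g k)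
    (ne_top_of_le_ne_top hint (lintegral_mono (hle k)))
    (fun x => (SimpleFunc.eapprox_lt_top g k x).ne)
  have hexp_le : ∀ x : ℝ≥0∞, Real.exp (-x.toReal) ≤ 1 := fun x =>
    Real.exp_le_one_iff.2 (neg_nonpos.2 ENNReal.toReal_nonneg)
  have hL : Filter.Tendsto
      (fun k => ∫ ω, Real.exp (-(∑' n, SimpleFunc.eapprox g k (U n ω)).toReal) ∂μ) Filter.atTop
      (nhds (∫ ω, Real.exp (-(∑' n, g (U n ω)).toReal) ∂μ)) := by
    refine tendsto_integral_of_dominated_convergence (fun _ => 1) ?_ (integrable_const _) ?_ ?_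
    · intro k
      have : Measurable fun ω => ∑' n, SimpleFunc.eapprox g k (U n ω) :=
        Measurable.tsum fun n => (SimpleFunc.measurable _).comp (hU.measurable n)
      exact (by fun_prop : Measurable fun ω =>
        Real.exp (-(∑' n, SimpleFunc.eapprox g k (U n ω)).toReal)).aestronglyMeasurable
    · intro k
      filter_upwards with ω
      rw [Real.norm_eq_abs, abs_of_pos (Real.exp_pos _)]
      exact hexp_le _
    · filter_upwards [hU.ae_tsum_ne_top hg hint] with ω hω
      have hT : Filter.Tendsto (fun k => ∑' n, SimpleFunc.eapprox g k (U n ω)) Filter.atTop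
          (nhds (∑' n, g (U n ω))) := by
        -- Reading the series as integrals over counting measure makes monotone convergence
        -- available.
        simp_rw [← lintegral_count]
        refine lintegral_tendsto_of_tendsto_of_monotone (fun k => measurable_from_nat.aemeasurable)
          (Filter.Eventually.of_forall fun n i j hij => hmono hij (U n ω))
          (Filter.Eventually.of_forall fun n => hlim (U n ω))
      exact (Real.continuous_exp.tendsto _).comp
        ((continuous_neg.tendsto _).comp ((ENNReal.tendsto_toReal hω).comp hT))
  have hR : Filter.Tendsto
      (fun k => ∫ x, (1 - Real.exp (-(SimpleFunc.eapprox g k x).toReal))) Filter.atTop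
      (nhds (∫ x, (1 - Real.exp (-(g x).toReal)))) := by
    refine tendsto_integral_of_dominated_convergence (fun x => (g x).toReal) ?_
      (integrable_toReal_of_lintegral_ne_top hg.aemeasurable hint) ?_ ?_
    · intro k
      exact (by fun_prop : Measurable fun x =>
        1 - Real.exp (-(SimpleFunc.eapprox g k x).toReal)).aestronglyMeasurable
    · intro k
      filter_upwards with x
      rw [Real.norm_eq_abs, abs_of_nonneg (sub_nonneg.2 (hexp_le _))]
      -- `1 - exp (-t) ≤ t` makes `g` itself the integrable majorant.
      have h1 := Real.add_one_le_exp (-(SimpleFunc.eapprox g k x).toReal)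
      have h2 := ENNReal.toReal_mono (hfin x) (hle k x)
      linarith
    · filter_upwards with x
      exact tendsto_const_nhds.sub ((Real.continuous_exp.tendsto _).comp
        ((continuous_neg.tendsto _).comp ((ENNReal.tendsto_toReal (hfin x)).comp (hlim x))))
  refine tendsto_nhds_unique hL ?_
  simp_rw [hsimple]
  exact (Real.continuous_exp.tendsto _).comp
    ((continuous_neg.tendsto _).comp (hR.const_mul lam))

end IsHomogeneousPPP

/-! ### Averaging over conditionally independent marks -/

theorem lintegral_pi_prod {ι S : Type*} [Fintype ι] [MeasurableSpace S] (ν : ι → Measure S)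
    [∀ i, IsProbabilityMeasure (ν i)] {f : ι → S → ℝ≥0∞} (hf : ∀ i, Measurable (f i)) :
    ∫⁻ x, ∏ i, f i (x i) ∂(Measure.pi ν) = ∏ i, ∫⁻ s, f i s ∂(ν i) := by
  have hind := iIndepFun_pi (μ := ν) (X := f) fun i => (hf i).aemeasurable
  refine (lintegral_prod_eq_prod_lintegral_of_indepFun Finset.univ (fun i (x : ι → S) => f i (x i)) hind
    fun i => (hf i).comp (measurable_pi_apply i)).trans ?_
  refine Finset.prod_congr rfl fun i _ => ?_
  rw [← (measurePreserving_eval ν i).lintegral_comp (hf i)]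

section Marks

variable {Ω E S : Type*} [MeasurableSpace Ω] [MeasurableSpace E] [MeasurableSpace S]

theorem measurable_measure_pi {ι : Type*} [Fintype ι] {κ : ι → E → Measure S}
    (hκ : ∀ i, Measurable (κ i)) [∀ i x, IsProbabilityMeasure (κ i x)] :
    Measurable fun x => Measure.pi fun i => κ i x := by
  refine Measurable.measure_of_isPiSystem_of_isProbabilityMeasure generateFrom_pi.symm
    isPiSystem_pi ?_
  rintro _ ⟨B, hB, rfl⟩
  simp_rw [Measure.pi_pi]
  exact Finset.measurable_prod _ fun i _ =>
    (Measure.measurable_coe (hB i (Set.mem_univ i))).comp (hκ i)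

/-- If, given the locations, the marks are independent and the mark of a point at `x` has law
`κ x`, then a product of functions of the marked points can be averaged over the marks factor by
factor. -/
theorem lintegral_prod_marks (μ : Measure Ω) [IsProbabilityMeasure μ] {U : ℕ → Ω → E}
    {M : ℕ → Ω → S} {κ : E → Measure S} (hU : ∀ n, Measurable (U n)) (hM : ∀ n, Measurable (M n))
    (hκ : Measurable κ) [∀ x, IsProbabilityMeasure (κ x)]
    (hmarks : ∀ A : Set (ℕ → E), MeasurableSet A → ∀ (k : ℕ) (B : ℕ → Set S),
      (∀ n, MeasurableSet (B n)) →
      μ {ω | (fun n => U n ω) ∈ A ∧ ∀ n < k, M n ω ∈ B n} =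
        ∫⁻ ω in {ω | (fun n => U n ω) ∈ A}, ∏ n ∈ Finset.range k, κ (U n ω) (B n) ∂μ)
    (k : ℕ) {F : ℕ → E → S → ℝ≥0∞} (hF : ∀ n, Measurable (Function.uncurry (F n))) :
    ∫⁻ ω, ∏ n ∈ Finset.range k, F n (U n ω) (M n ω) ∂μ =
      ∫⁻ ω, ∏ n ∈ Finset.range k, ∫⁻ s, F n (U n ω) s ∂κ (U n ω) ∂μ := by
  have hUm : Measurable fun ω n => U n ω := measurable_pi_lambda _ hU
  have hMm : Measurable fun ω (n : Fin k) => M n ω := measurable_pi_lambda _ fun n => hM n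
  -- The conditional law of the first `k` marks given all locations. The marks hypothesis identifies
  -- the joint law with the composition product of the location law and `K`, first on boxes.
  let K : Kernel (ℕ → E) (Fin k → S) :=
    ⟨fun u => Measure.pi fun n : Fin k => κ (u n),
      measurable_measure_pi fun n => hκ.comp (measurable_pi_apply _)⟩
  have : IsMarkovKernel K := ⟨fun u => by dsimp [K]; infer_instance⟩
  have : IsProbabilityMeasure (μ.map fun ω n => U n ω) :=
    Measure.isProbabilityMeasure_map hUm.aemeasurable
  have hbox : ∀ A : Set (ℕ → E), MeasurableSet A → ∀ B : Fin k → Set S,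
      (∀ i, MeasurableSet (B i)) →
      (μ.map fun ω => ((fun n => U n ω), fun n : Fin k => M n ω)) (A ×ˢ Set.univ.pi B) =
        ((μ.map fun ω n => U n ω) ⊗ₘ K) (A ×ˢ Set.univ.pi B) := by
    intro A hA B hB
    have hBm : MeasurableSet (Set.univ.pi B) := MeasurableSet.univ_pi hB
    rw [Measure.map_apply (hUm.prodMk hMm) (hA.prod hBm), Measure.compProd_apply_prod hA hBm,
      setLIntegral_map hA (K.measurable_coe hBm) hUm]
    have h := hmarks A hA k (fun n => if h : n < k then B ⟨n, h⟩ else Set.univ) (by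
      intro n
      split_ifs
      exacts [hB _, MeasurableSet.univ])
    convert h using 2
    · ext ω
      simp only [Set.mem_preimage, Set.mem_prod, Set.mem_univ_pi, Set.mem_ofPred_eq, Fin.forall_iff]
      refine and_congr_right fun _ => forall₂_congr fun n hn => ?_
      rw [dif_pos hn]
    · rfl
    · funext ω
      change Measure.pi (fun n : Fin k => κ (U n ω)) (Set.univ.pi B) = _
      rw [Measure.pi_pi, Finset.prod_range]
      refine Finset.prod_congr rfl fun n _ => ?_
      rw [dif_pos n.2]
  have hjoint : μ.map (fun ω => ((fun n => U n ω), fun n : Fin k => M n ω)) =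
      (μ.map fun ω n => U n ω) ⊗ₘ K := by
    have : IsProbabilityMeasure
        (μ.map fun ω => ((fun n => U n ω), fun n : Fin k => M n ω)) :=
      Measure.isProbabilityMeasure_map (hUm.prodMk hMm).aemeasurable
    refine Measure.ext_prod fun {A t} hA ht => ?_
    -- For fixed `A`, `t ↦ ρ (A ×ˢ t)` is a finite measure, so agreement on boxes extends to every
    -- measurable `t` by the π-system argument.
    have hsec : ∀ ρ : Measure ((ℕ → E) × (Fin k → S)), ∀ t, MeasurableSet t →
        ((ρ.restrict (A ×ˢ Set.univ)).map Prod.snd) t = ρ (A ×ˢ t) := by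
      intro ρ t ht
      rw [Measure.map_apply measurable_snd ht, Measure.restrict_apply (measurable_snd ht)]
      congr 1
      ext x
      simp [and_comm]
    rw [← hsec _ t ht, ← hsec _ t ht]
    congr 1
    refine ext_of_generate_finite _ generateFrom_pi.symm isPiSystem_pi ?_ ?_
    · rintro _ ⟨B, hB, rfl⟩
      have hB' : ∀ i, MeasurableSet (B i) := fun i => hB i (Set.mem_univ i)
      rw [hsec _ _ (MeasurableSet.univ_pi hB'), hsec _ _ (MeasurableSet.univ_pi hB')]
      exact hbox A hA B hB'
    · rw [hsec _ _ MeasurableSet.univ, hsec _ _ MeasurableSet.univ, ← Set.pi_univ Set.univ]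
      exact hbox A hA (fun _ => Set.univ) fun _ => MeasurableSet.univ
  have hFm : Measurable fun p : (ℕ → E) × (Fin k → S) => ∏ n : Fin k, F n (p.1 n) (p.2 n) :=
    Finset.measurable_prod _ fun n _ => (hF n).comp
      (f := fun p : (ℕ → E) × (Fin k → S) => (p.1 n, p.2 n)) (by fun_prop)
  calc ∫⁻ ω, ∏ n ∈ Finset.range k, F n (U n ω) (M n ω) ∂μ
      = ∫⁻ p, ∏ n : Fin k, F n (p.1 n) (p.2 n)
          ∂(μ.map fun ω => ((fun n => U n ω), fun n : Fin k => M n ω)) := by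
        rw [lintegral_map hFm (hUm.prodMk hMm)]
        simp_rw [Finset.prod_range]
    _ = ∫⁻ u, ∫⁻ m, ∏ n : Fin k, F n (u n) (m n) ∂(K u) ∂(μ.map fun ω n => U n ω) := by
        rw [hjoint, Measure.lintegral_compProd hFm]
    _ = ∫⁻ ω, ∫⁻ m, ∏ n : Fin k, F n (U n ω) (m n) ∂(K fun n => U n ω) ∂μ :=
        lintegral_map hFm.lintegral_kernel_prod_right' hUm
    _ = _ := by
        refine lintegral_congr fun ω => ?_
        rw [Finset.prod_range]
        exact lintegral_pi_prod (fun n : Fin k => κ (U n ω))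
          fun n => (hF n).comp measurable_prodMk_left

/-- The one-point version of `lintegral_prod_marks`. -/
theorem lintegral_mark (μ : Measure Ω) [IsProbabilityMeasure μ] {U : ℕ → Ω → E}
    {M : ℕ → Ω → S} {κ : E → Measure S} (hU : ∀ n, Measurable (U n)) (hM : ∀ n, Measurable (M n))
    (hκ : Measurable κ) [∀ x, IsProbabilityMeasure (κ x)]
    (hmarks : ∀ A : Set (ℕ → E), MeasurableSet A → ∀ (k : ℕ) (B : ℕ → Set S),
      (∀ n, MeasurableSet (B n)) →
      μ {ω | (fun n => U n ω) ∈ A ∧ ∀ n < k, M n ω ∈ B n} =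
        ∫⁻ ω in {ω | (fun n => U n ω) ∈ A}, ∏ n ∈ Finset.range k, κ (U n ω) (B n) ∂μ)
    (n : ℕ) {F : E → S → ℝ≥0∞} (hF : Measurable (Function.uncurry F)) :
    ∫⁻ ω, F (U n ω) (M n ω) ∂μ = ∫⁻ ω, ∫⁻ s, F (U n ω) s ∂κ (U n ω) ∂μ := by
  -- All factors except the `n`-th are set to `1`.
  have h := lintegral_prod_marks μ hU hM hκ hmarks (n + 1)
    (F := fun i x s => if i = n then F x s else 1) (by
      intro i
      by_cases hi : i = n
      · simpa [hi] using hF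
      · simp [hi, Function.uncurry_def])
  simp only [Finset.prod_range_succ, if_true] at h
  have h1 : ∀ ω, ∏ i ∈ Finset.range n, (if i = n then F (U i ω) (M i ω) else 1) = 1 := fun ω =>
    Finset.prod_eq_one fun i hi => if_neg (Finset.mem_range.1 hi).ne
  have h2 : ∀ ω, ∏ i ∈ Finset.range n,
      (∫⁻ s, (if i = n then F (U i ω) s else 1) ∂κ (U i ω)) = 1 := fun ω =>
    Finset.prod_eq_one fun i hi => by simp [(Finset.mem_range.1 hi).ne]
  simpa only [h1, h2, one_mul] using h

end Marks

/-! ### Gamma fading -/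

theorem lintegral_rpow_mul_exp_neg_mul {K a r : ℝ} (hK : 0 ≤ K) (ha : 0 < a) (hr : 0 < r) :
    ∫⁻ x in Set.Ioi (0 : ℝ), ENNReal.ofReal (K * (x ^ (a - 1) * Real.exp (-(r * x)))) =
      ENNReal.ofReal (K * ((1 / r) ^ a * Real.Gamma a)) := by
  have hval := Real.integral_rpow_mul_exp_neg_mul_Ioi ha hr
  have hint : IntegrableOn (fun x : ℝ => x ^ (a - 1) * Real.exp (-(r * x))) (Set.Ioi 0) := by
    -- A non-integrable function would have integral `0` by convention, but the known value is
    -- positive.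
    by_contra h
    rw [integral_undef h] at hval
    have := Real.Gamma_pos_of_pos ha
    exact absurd hval (by positivity : (0:ℝ) < (1 / r) ^ a * Real.Gamma a).ne
  rw [← hval, ← integral_const_mul, ofReal_integral_eq_lintegral_ofReal (hint.const_mul K)]
  filter_upwards [ae_restrict_mem measurableSet_Ioi] with x hx
  have : (0 : ℝ) < x := hx
  simp only [Pi.zero_apply]
  positivity

theorem lintegral_gammaMeasure (a r : ℝ) {f : ℝ → ℝ≥0∞} (hf : Measurable f) :
    ∫⁻ x, f x ∂(gammaMeasure a r) =
      ∫⁻ x in Set.Ioi (0 : ℝ),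
        ENNReal.ofReal (r ^ a / Real.Gamma a * x ^ (a - 1) * Real.exp (-(r * x))) * f x := by
  have hm : Measurable (gammaPDF a r) := (measurable_gammaPDFReal a r).ennreal_ofReal
  rw [gammaMeasure, lintegral_withDensity_eq_lintegral_mul _ hm hf,
    ← lintegral_add_compl _ (measurableSet_Ici (a := (0 : ℝ))), Set.compl_Ici,
    setLIntegral_congr (f := gammaPDF a r * f) Ioi_ae_eq_Ici.symm,
    setLIntegral_congr_fun (g := fun _ => 0) measurableSet_Iio, lintegral_zero, add_zero]
  · refine setLIntegral_congr_fun measurableSet_Ioi fun x hx => ?_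
    simp only [Pi.mul_apply]
    rw [gammaPDF_of_nonneg (le_of_lt hx)]
  · intro x hx
    simp [gammaPDF_of_neg hx]

theorem lintegral_exp_neg_mul_gammaMeasure {m c : ℝ} (hm : 0 < m) (hc : 0 ≤ c) :
    ∫⁻ x, ENNReal.ofReal (Real.exp (-(c * x))) ∂(gammaMeasure m m) =
      ENNReal.ofReal ((1 + c / m) ^ (-m)) := by
  have hG := Real.Gamma_pos_of_pos hm
  rw [lintegral_gammaMeasure _ _ (by fun_prop)]
  have h := lintegral_rpow_mul_exp_neg_mul (K := m ^ m / Real.Gamma m) (by positivity) hm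
    (by positivity : 0 < m + c)
  convert h using 1
  · refine setLIntegral_congr_fun measurableSet_Ioi fun x hx => ?_
    have : (0 : ℝ) < x := hx
    rw [← ENNReal.ofReal_mul (by positivity), mul_assoc, mul_assoc, ← Real.exp_add]
    ring_nf
  · congr 1
    have h1 : 1 + c / m = (m + c) / m := by field_simp
    rw [h1, Real.rpow_neg (by positivity), Real.div_rpow (by positivity) hm.le,
      Real.div_rpow zero_le_one (by positivity), Real.one_rpow]
    have : 0 < (m + c) ^ m := by positivity
    field_simp

theorem lintegral_id_gammaMeasure {m : ℝ} (hm : 0 < m) :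
    ∫⁻ x, ENNReal.ofReal x ∂(gammaMeasure m m) = 1 := by
  have hG := Real.Gamma_pos_of_pos hm
  rw [lintegral_gammaMeasure _ _ (by fun_prop)]
  have h := lintegral_rpow_mul_exp_neg_mul (K := m ^ m / Real.Gamma m) (by positivity)
    (by positivity : 0 < m + 1) hm
  convert h using 1
  · refine setLIntegral_congr_fun measurableSet_Ioi fun x hx => ?_
    have hx : (0 : ℝ) < x := hx
    rw [← ENNReal.ofReal_mul (by positivity), add_sub_cancel_right]
    have hpow : x ^ m = x ^ (m - 1) * x := by rw [← Real.rpow_add_one hx.ne', sub_add_cancel]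
    rw [hpow]
    congr 1
    ring
  · rw [Real.Gamma_add_one hm.ne', Real.div_rpow zero_le_one hm.le, Real.one_rpow,
      Real.rpow_add_one hm.ne', ← ENNReal.ofReal_one]
    congr 1
    have : 0 < m ^ m := by positivity
    field_simp

theorem gammaMeasure_Iio_zero (a r : ℝ) : gammaMeasure a r (Set.Iio 0) = 0 := by
  rw [gammaMeasure, withDensity_apply _ measurableSet_Iio]
  exact lintegral_gammaPDF_of_nonpos le_rfl

/-- This is Jensen's inequality for mean-one Gamma fading. Directly, it is `1 + t/m ≤ exp (t/m)`
raised to the power `-m`. -/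
theorem Real.exp_neg_le_one_add_div_rpow {m t : ℝ} (hm : 0 < m) (ht : 0 ≤ t) :
    Real.exp (-t) ≤ (1 + t / m) ^ (-m) := by
  have h1 : 1 + t / m ≤ Real.exp (t / m) := by linarith [Real.add_one_le_exp (t / m)]
  have h2 := Real.rpow_le_rpow_of_nonpos (by positivity) h1 (neg_nonpos.2 hm.le)
  rw [← Real.exp_mul] at h2
  convert h2 using 2
  field_simp

/-! ### The law of a single link and its power transform -/

namespace NetworkParams

variable (P : NetworkParams)

theorem losProb_mem (q : ℝ) : P.losProb q ∈ Set.Icc 0 1 := by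
  have ha := P.a_nonneg
  unfold losProb
  set e := Real.exp (-(P.b * (180 / Real.pi * Real.arctan (P.h / q) - P.a)))
  have he : 0 < e := Real.exp_pos _
  have h1 : 1 ≤ 1 + P.a * e := by nlinarith [mul_nonneg ha he.le]
  exact ⟨by positivity, (div_le_one (by positivity)).2 h1⟩

theorem linkProb_nonneg (z : LinkType) (q : ℝ) : 0 ≤ P.linkProb z q := by
  cases z
  · exact (P.losProb_mem q).1
  · exact sub_nonneg.2 (P.losProb_mem q).2

theorem sum_linkType {M : Type*} [AddCommMonoid M] (f : LinkType → M) :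
    ∑ z, f z = f LinkType.los + f LinkType.nlos := by
  have : (Finset.univ : Finset LinkType) = {LinkType.los, LinkType.nlos} := rfl
  rw [this, Finset.sum_pair (by decide)]

theorem sum_linkProb (q : ℝ) : ∑ z, P.linkProb z q = 1 := by
  rw [sum_linkType]
  simp [linkProb]

theorem linkProb_le_one (z : LinkType) (q : ℝ) : P.linkProb z q ≤ 1 := by
  rw [← P.sum_linkProb q]
  exact Finset.single_le_sum (f := fun z => P.linkProb z q)
    (fun z _ => P.linkProb_nonneg z q) (Finset.mem_univ z)

theorem measurable_linkProb (z : LinkType) : Measurable (P.linkProb z) := by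
  have h : Measurable P.losProb := by
    unfold losProb
    fun_prop
  cases z
  · exact h
  · exact measurable_const.sub h

theorem gain_nonneg (i : Fin 4) : 0 ≤ P.gain i := by
  have h1 := P.mainU_nonneg
  have h2 := P.sideU_nonneg
  have h3 := P.mainD_nonneg
  have h4 := P.sideD_nonneg
  fin_cases i <;> simp [gain] <;> positivity

theorem gainProb_nonneg (i : Fin 4) : 0 ≤ P.gainProb i := by
  have hpi : 0 < 2 * Real.pi := by positivity
  have hu : 0 ≤ P.θU / (2 * Real.pi) := div_nonneg P.θU_mem.1 hpi.le
  have hd : 0 ≤ P.θD / (2 * Real.pi) := div_nonneg P.θD_mem.1 hpi.le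
  have hu' : 0 ≤ 1 - P.θU / (2 * Real.pi) := sub_nonneg.2 ((div_le_one hpi).2 P.θU_mem.2)
  have hd' : 0 ≤ 1 - P.θD / (2 * Real.pi) := sub_nonneg.2 ((div_le_one hpi).2 P.θD_mem.2)
  fin_cases i
  · exact mul_nonneg hu hd
  · exact mul_nonneg hu hd'
  · exact mul_nonneg hu' hd
  · exact mul_nonneg hu' hd'

theorem sum_gainProb : ∑ i, P.gainProb i = 1 := by
  simp only [gainProb, Fin.sum_univ_four, Matrix.cons_val]
  ring

theorem lintegral_markLaw (q : ℝ) {F : LinkType × ℝ × ℝ → ℝ≥0∞} (hF : Measurable F) :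
    ∫⁻ s, F s ∂(P.markLaw q) = ∑ z, ENNReal.ofReal (P.linkProb z q) *
      ∑ i, ENNReal.ofReal (P.gainProb i) * ∫⁻ x, F (z, P.gain i, x) ∂(P.fadingLaw z) := by
  have hprob : ∀ z, IsProbabilityMeasure (P.fadingLaw z) := fun z =>
    isProbabilityMeasure_gammaMeasure (P.m_pos z) (P.m_pos z)
  have : IsFiniteMeasure P.gainLaw := by
    unfold gainLaw
    refine ⟨?_⟩
    simp only [Measure.coe_finsetSum, Finset.sum_apply, Measure.smul_apply, measure_univ,
      smul_eq_mul, mul_one]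
    exact ENNReal.sum_lt_top.2 fun i _ => ENNReal.ofReal_lt_top
  rw [markLaw, lintegral_finsetSum_measure]
  refine Finset.sum_congr rfl fun z _ => ?_
  rw [lintegral_smul_measure, smul_eq_mul, lintegral_prod _ hF.aemeasurable, lintegral_dirac',
    lintegral_prod (fun y => F (z, y)) (hF.comp measurable_prodMk_left).aemeasurable, gainLaw,
    lintegral_finsetSum_measure]
  · congr 1
    refine Finset.sum_congr rfl fun i _ => ?_
    rw [lintegral_smul_measure, smul_eq_mul, lintegral_dirac' ]
    exact Measurable.lintegral_prod_right' (f := fun y => F (z, y)) (hF.comp measurable_prodMk_left)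
  · exact hF.lintegral_prod_right'

instance isProbabilityMeasure_markLaw (q : ℝ) : IsProbabilityMeasure (P.markLaw q) := by
  have hprob : ∀ z, IsProbabilityMeasure (P.fadingLaw z) := fun z =>
    isProbabilityMeasure_gammaMeasure (P.m_pos z) (P.m_pos z)
  refine ⟨?_⟩
  rw [← lintegral_one, P.lintegral_markLaw q measurable_const]
  simp only [lintegral_one, measure_univ, mul_one]
  rw [← ENNReal.ofReal_sum_of_nonneg fun i _ => P.gainProb_nonneg i, P.sum_gainProb]
  simp only [ENNReal.ofReal_one, mul_one]
  rw [← ENNReal.ofReal_sum_of_nonneg fun z _ => P.linkProb_nonneg z q, P.sum_linkProb,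
    ENNReal.ofReal_one]

theorem measurable_markLaw : Measurable P.markLaw := by
  refine Measure.measurable_of_measurable_coe _ fun B hB => ?_
  simp only [markLaw, Measure.coe_finsetSum, Finset.sum_apply, Measure.smul_apply, smul_eq_mul]
  exact Finset.measurable_sum _ fun z _ =>
    (P.measurable_linkProb z).ennreal_ofReal.mul_const _

/-- The path loss of a link of type `z` and horizontal length `q`. -/
noncomputable def pathLoss (z : LinkType) (q : ℝ) : ℝ := (q ^ 2 + P.h ^ 2) ^ (-(P.α z) / 2)

/-- The power received over a link of horizontal length `q` with the given mark. -/
noncomputable def markPower (q : ℝ) (s : LinkType × ℝ × ℝ) : ℝ :=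
  P.Pu * s.2.1 * s.2.2 * P.pathLoss s.1 q

/-- The mean power received over a link of type `z` and horizontal length `q`. -/
noncomputable def meanPower (z : LinkType) (q : ℝ) : ℝ :=
  ∑ i, P.gainProb i * (P.Pu * P.gain i * P.pathLoss z q)

/-- The Laplace transform of the power received over a link of type `z` and horizontal
length `q`. -/
noncomputable def powerTransform (s : ℝ) (z : LinkType) (q : ℝ) : ℝ :=
  ∑ i, P.gainProb i * (1 + s * P.Pu * P.gain i * P.pathLoss z q / P.m z) ^ (-(P.m z))

theorem pathLoss_pos (z : LinkType) (q : ℝ) : 0 < P.pathLoss z q := by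
  have := P.h_pos
  exact Real.rpow_pos_of_pos (by positivity) _

theorem measurable_pathLoss (z : LinkType) : Measurable (P.pathLoss z) := by
  unfold pathLoss
  fun_prop

theorem measurable_markPower : Measurable (Function.uncurry P.markPower) := by
  have hα : Measurable P.α := measurable_from_top
  unfold markPower pathLoss Function.uncurry
  fun_prop

theorem measurable_markPower_right (q : ℝ) : Measurable (P.markPower q) :=
  P.measurable_markPower.comp measurable_prodMk_left

theorem power_nonneg (i : Fin 4) (z : LinkType) (q : ℝ) :
    0 ≤ P.Pu * P.gain i * P.pathLoss z q :=
  mul_nonneg (mul_nonneg P.Pu_pos.le (P.gain_nonneg i)) (P.pathLoss_pos z q).le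

theorem meanPower_nonneg (z : LinkType) (q : ℝ) : 0 ≤ P.meanPower z q :=
  Finset.sum_nonneg fun i _ => mul_nonneg (P.gainProb_nonneg i) (P.power_nonneg i z q)

theorem measurable_meanPower (z : LinkType) : Measurable (P.meanPower z) :=
  Finset.measurable_sum _ fun _ _ => ((P.measurable_pathLoss z).const_mul _).const_mul _

theorem measurable_powerTransform (s : ℝ) (z : LinkType) : Measurable (P.powerTransform s z) := by
  have := P.measurable_pathLoss z
  unfold powerTransform
  fun_prop

theorem powerTransform_le_one {s : ℝ} (hs : 0 ≤ s) (z : LinkType) (q : ℝ) :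
    P.powerTransform s z q ≤ 1 := by
  rw [← P.sum_gainProb]
  refine Finset.sum_le_sum fun i _ => mul_le_of_le_one_right (P.gainProb_nonneg i) ?_
  have h := mul_nonneg hs (P.power_nonneg i z q)
  refine Real.rpow_le_one_of_one_le_of_nonpos ?_ (neg_nonpos.2 (P.m_pos z).le)
  rw [mul_assoc s, mul_assoc s]
  have := div_nonneg h (P.m_pos z).le
  linarith

/-- Convexity of `exp` handles the average over gains, and `Real.exp_neg_le_one_add_div_rpow` the
fading. The bound gives both positivity of the transform and the integrable majorant of `1 -
powerTransform`. -/
theorem exp_neg_le_powerTransform {s : ℝ} (hs : 0 ≤ s) (z : LinkType) (q : ℝ) :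
    Real.exp (-(s * P.meanPower z q)) ≤ P.powerTransform s z q := by
  have h := convexOn_exp.map_sum_le (t := Finset.univ) (w := P.gainProb)
    (p := fun i => -(s * (P.Pu * P.gain i * P.pathLoss z q)))
    (fun i _ => P.gainProb_nonneg i) P.sum_gainProb (fun i _ => Set.mem_univ _)
  simp only [smul_eq_mul] at h
  calc Real.exp (-(s * P.meanPower z q))
      = Real.exp (∑ i, P.gainProb i * -(s * (P.Pu * P.gain i * P.pathLoss z q))) := by
        congr 1
        rw [meanPower, Finset.mul_sum, ← Finset.sum_neg_distrib]
        exact Finset.sum_congr rfl fun i _ => by ring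
    _ ≤ _ := h
    _ ≤ P.powerTransform s z q := by
        refine Finset.sum_le_sum fun i _ => mul_le_mul_of_nonneg_left ?_ (P.gainProb_nonneg i)
        rw [mul_assoc s, mul_assoc s]
        exact Real.exp_neg_le_one_add_div_rpow (P.m_pos z) (mul_nonneg hs (P.power_nonneg i z q))

theorem one_sub_powerTransform_le {s : ℝ} (hs : 0 ≤ s) (z : LinkType) (q : ℝ) :
    1 - P.powerTransform s z q ≤ s * P.meanPower z q := by
  have h1 := P.exp_neg_le_powerTransform hs z q
  have h2 := Real.add_one_le_exp (-(s * P.meanPower z q))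
  linarith

theorem lintegral_markPower (q : ℝ) :
    ∫⁻ s, ENNReal.ofReal (P.markPower q s) ∂(P.markLaw q) =
      ENNReal.ofReal (∑ z, P.linkProb z q * P.meanPower z q) := by
  rw [P.lintegral_markLaw q (P.measurable_markPower_right q).ennreal_ofReal,
    ENNReal.ofReal_sum_of_nonneg fun z _ =>
      mul_nonneg (P.linkProb_nonneg z q) (P.meanPower_nonneg z q)]
  refine Finset.sum_congr rfl fun z _ => ?_
  rw [ENNReal.ofReal_mul (P.linkProb_nonneg z q), meanPower, ENNReal.ofReal_sum_of_nonneg fun i _ =>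
    mul_nonneg (P.gainProb_nonneg i) (P.power_nonneg i z q)]
  congr 1
  refine Finset.sum_congr rfl fun i _ => ?_
  rw [ENNReal.ofReal_mul (P.gainProb_nonneg i)]
  congr 1
  have : ∀ x, ENNReal.ofReal (P.markPower q (z, P.gain i, x)) =
      ENNReal.ofReal (P.Pu * P.gain i * P.pathLoss z q) * ENNReal.ofReal x := by
    intro x
    rw [← ENNReal.ofReal_mul (P.power_nonneg i z q), markPower]
    ring_nf
  simp_rw [this]
  rw [lintegral_const_mul _ (by fun_prop), fadingLaw, lintegral_id_gammaMeasure (P.m_pos z),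
    mul_one]

theorem lintegral_exp_neg_markPower {s : ℝ} (hs : 0 ≤ s) (q : ℝ) :
    ∫⁻ x, ENNReal.ofReal (Real.exp (-(s * P.markPower q x))) ∂(P.markLaw q) =
      ENNReal.ofReal (∑ z, P.linkProb z q * P.powerTransform s z q) := by
  have hpos : ∀ z i, 0 ≤ (1 + s * P.Pu * P.gain i * P.pathLoss z q / P.m z) ^ (-(P.m z)) := by
    intro z i
    have h := div_nonneg (mul_nonneg hs (P.power_nonneg i z q)) (P.m_pos z).le
    rw [mul_assoc s, mul_assoc s]
    positivity
  have hT : ∀ z, 0 ≤ P.powerTransform s z q := fun z =>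
    (Real.exp_pos _).le.trans (P.exp_neg_le_powerTransform hs z q)
  have hm := P.measurable_markPower_right q
  rw [P.lintegral_markLaw q (by fun_prop), ENNReal.ofReal_sum_of_nonneg fun z _ =>
      mul_nonneg (P.linkProb_nonneg z q) (hT z)]
  refine Finset.sum_congr rfl fun z _ => ?_
  rw [ENNReal.ofReal_mul (P.linkProb_nonneg z q), powerTransform,
    ENNReal.ofReal_sum_of_nonneg fun i _ => mul_nonneg (P.gainProb_nonneg i) (hpos z i)]
  congr 1
  refine Finset.sum_congr rfl fun i _ => ?_
  rw [ENNReal.ofReal_mul (P.gainProb_nonneg i)]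
  congr 1
  rw [mul_assoc s, mul_assoc s, ← lintegral_exp_neg_mul_gammaMeasure (P.m_pos z)
    (mul_nonneg hs (P.power_nonneg i z q)), fadingLaw]
  refine lintegral_congr fun x => ?_
  rw [markPower]
  ring_nf

/-- Gains are nonnegative and the Gamma law does not charge negative numbers. The indicator form
fits `lintegral_mark`, which transfers the fact to the received powers. -/
theorem lintegral_markPower_neg (q : ℝ) :
    ∫⁻ s, (if P.markPower q s < 0 then 1 else 0) ∂(P.markLaw q) = 0 := by
  have hm : Measurable fun s => (if P.markPower q s < 0 then 1 else 0 : ℝ≥0∞) :=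
    Measurable.ite (measurableSet_lt (P.measurable_markPower_right q)
      measurable_const) measurable_const measurable_const
  rw [P.lintegral_markLaw q hm]
  refine Finset.sum_eq_zero fun z _ => mul_eq_zero_of_right _ ?_
  refine Finset.sum_eq_zero fun i _ => mul_eq_zero_of_right _ ?_
  refine (lintegral_eq_zero_iff
    (hm.comp (by fun_prop : Measurable fun x : ℝ => (z, P.gain i, x)))).2 ?_
  have h : ∀ᵐ x ∂(P.fadingLaw z), 0 ≤ x := by
    rw [ae_iff]
    simp only [not_le]
    exact gammaMeasure_Iio_zero _ _
  filter_upwards [h] with x hx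
  have : 0 ≤ P.markPower q (z, P.gain i, x) := by
    have := mul_nonneg (P.power_nonneg i z q) hx
    rw [markPower]
    linarith
  simp [not_lt.2 this]

/-- The path loss is integrable over the plane since its exponent exceeds the dimension. -/
theorem integrable_pathLoss (z : LinkType) :
    Integrable fun x : Plane => P.pathLoss z ‖x‖ := by
  have hα := P.α_gt_two z
  have hh := P.h_pos
  have h := integrable_rpow_neg_one_add_norm_sq (E := Plane) (r := P.α z)
    (μ := volume) (by simpa using hα)
  -- With this `c`, `c * (1 + ‖x‖ ^ 2) ≤ ‖x‖ ^ 2 + h ^ 2`, which reduces the claim to the standard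
  -- integrable function.
  set c := min 1 (P.h ^ 2)
  have hc : 0 < c := lt_min one_pos (by positivity)
  refine (h.const_mul (c ^ (-(P.α z) / 2))).mono'
    ((P.measurable_pathLoss z).comp measurable_norm).aestronglyMeasurable ?_
  filter_upwards with x
  rw [Real.norm_eq_abs, abs_of_pos (P.pathLoss_pos z _), ← Real.mul_rpow hc.le (by positivity)]
  refine Real.rpow_le_rpow_of_nonpos (by positivity) ?_ (by linarith)
  have h1 : c ≤ 1 := min_le_left _ _
  have h2 : c ≤ P.h ^ 2 := min_le_right _ _
  nlinarith [mul_le_mul_of_nonneg_right h1 (sq_nonneg ‖x‖)]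

theorem integrable_meanPower (z : LinkType) :
    Integrable fun x : Plane => P.meanPower z ‖x‖ :=
  integrable_finsetSum _ fun _ _ => ((P.integrable_pathLoss z).const_mul _).const_mul _

theorem integrable_one_sub_powerTransform {s : ℝ} (hs : 0 ≤ s) (z : LinkType) :
    Integrable fun x : Plane => (1 - P.powerTransform s z ‖x‖) * P.linkProb z ‖x‖ := by
  refine ((P.integrable_meanPower z).const_mul s).mono' ?_ ?_
  · exact (((measurable_const.sub (P.measurable_powerTransform s z)).mul
      (P.measurable_linkProb z)).comp measurable_norm).aestronglyMeasurable
  · filter_upwards with x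
    have h0 := sub_nonneg.2 (P.powerTransform_le_one hs z ‖x‖)
    rw [Real.norm_eq_abs, abs_of_nonneg (mul_nonneg h0 (P.linkProb_nonneg z _))]
    exact (mul_le_of_le_one_right h0 (P.linkProb_le_one z _)).trans
      (P.one_sub_powerTransform_le hs z _)

end NetworkParams

/-! ### Polar coordinates and integrability around the receiver -/

theorem integral_fun_norm_plane (f : ℝ → ℝ) :
    ∫ x : Plane, f ‖x‖ = 2 * Real.pi * ∫ q in Set.Ioi (0 : ℝ), q * f q := by
  rw [integral_fun_norm_addHaar]
  simp only [finrank_euclideanSpace, Fintype.card_fin, Measure.real,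
    EuclideanSpace.volume_ball_fin_two]
  simp [mul_assoc, Real.pi_pos.le]

theorem integrableOn_mul_of_integrable_fun_norm {f : ℝ → ℝ}
    (hf : Integrable fun x : Plane => f ‖x‖) :
    IntegrableOn (fun q : ℝ => q * f q) (Set.Ioi 0) := by
  simpa using (integrable_fun_norm_addHaar (volume : Measure Plane)).1 hf

namespace NetworkParams

variable (P : NetworkParams)

theorem measurable_markLaw_norm_sub (y : Plane) :
    Measurable fun x : Plane => P.markLaw ‖x - y‖ :=
  P.measurable_markLaw.comp (measurable_id.sub_const y).norm

theorem measurable_markPower_norm_sub (y : Plane) :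
    Measurable fun p : Plane × (LinkType × ℝ × ℝ) => P.markPower ‖p.1 - y‖ p.2 :=
  P.measurable_markPower.comp ((measurable_fst.sub_const y).norm.prodMk measurable_snd)

theorem integrable_linkProb_mul_meanPower (y : Plane) :
    Integrable fun x : Plane => ∑ z, P.linkProb z ‖x - y‖ * P.meanPower z ‖x - y‖ := by
  refine integrable_finsetSum _ fun z _ => ?_
  have h : Integrable fun x : Plane => P.linkProb z ‖x‖ * P.meanPower z ‖x‖ := by
    refine (P.integrable_meanPower z).mono' ?_ ?_
    · exact (((P.measurable_linkProb z).mul (P.measurable_meanPower z)).comp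
        measurable_norm).aestronglyMeasurable
    · filter_upwards with x
      rw [Real.norm_eq_abs,
        abs_of_nonneg (mul_nonneg (P.linkProb_nonneg z _) (P.meanPower_nonneg z _))]
      exact mul_le_of_le_one_left (P.meanPower_nonneg z _) (P.linkProb_le_one z _)
  exact h.comp_sub_right y

end NetworkParams

/-! ### Summability and Laplace transform of the interference -/

namespace IsInterferenceField

variable {Ω : Type*} [MeasurableSpace Ω] {μ : Measure Ω} {P : NetworkParams} {y : Plane}
  {U : ℕ → Ω → Plane} {Z : ℕ → Ω → LinkType} {G H : ℕ → Ω → ℝ}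

theorem measurable_mark (hf : IsInterferenceField μ P y U Z G H) (n : ℕ) :
    Measurable fun ω => (Z n ω, G n ω, H n ω) :=
  (hf.measurable_type n).prodMk ((hf.measurable_gain n).prodMk (hf.measurable_fading n))

theorem measurable_receivedPower (hf : IsInterferenceField μ P y U Z G H) (n : ℕ) :
    Measurable (receivedPower P y U Z G H n) :=
  P.measurable_markPower.comp
    (((hf.poisson.measurable n).sub_const y).norm.prodMk (hf.measurable_mark n))

theorem ae_receivedPower_nonneg [IsProbabilityMeasure μ]
    (hf : IsInterferenceField μ P y U Z G H) :
    ∀ᵐ ω ∂μ, ∀ n, 0 ≤ receivedPower P y U Z G H n ω := by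
  rw [ae_all_iff]
  intro n
  have hm : Measurable (Function.uncurry fun (x : Plane) (s : LinkType × ℝ × ℝ) =>
      (if P.markPower ‖x - y‖ s < 0 then 1 else 0 : ℝ≥0∞)) :=
    Measurable.ite (measurableSet_lt (P.measurable_markPower_norm_sub y) measurable_const)
      measurable_const measurable_const
  have h := lintegral_mark μ hf.poisson.measurable hf.measurable_mark
    (P.measurable_markLaw_norm_sub y) hf.marks n hm
  simp only [P.lintegral_markPower_neg, lintegral_zero] at h
  have h' := (lintegral_eq_zero_iff
    (hm.comp ((hf.poisson.measurable n).prodMk (hf.measurable_mark n)))).1 h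
  filter_upwards [h'] with ω hω
  by_contra hneg
  have : P.markPower ‖U n ω - y‖ (Z n ω, G n ω, H n ω) < 0 := not_le.1 hneg
  simp [Function.uncurry, this] at hω

theorem ae_summable [IsProbabilityMeasure μ] (hf : IsInterferenceField μ P y U Z G H) :
    ∀ᵐ ω ∂μ, Summable fun n => receivedPower P y U Z G H n ω := by
  have hm : Measurable (Function.uncurry fun (x : Plane) (s : LinkType × ℝ × ℝ) =>
      ENNReal.ofReal (P.markPower ‖x - y‖ s)) :=
    (P.measurable_markPower_norm_sub y).ennreal_ofReal
  have hmean : ∀ n, ∫⁻ ω, ENNReal.ofReal (receivedPower P y U Z G H n ω) ∂μ =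
      ∫⁻ ω, ENNReal.ofReal
        (∑ z, P.linkProb z ‖U n ω - y‖ * P.meanPower z ‖U n ω - y‖) ∂μ := by
    intro n
    have h := lintegral_mark μ hf.poisson.measurable hf.measurable_mark
      (P.measurable_markLaw_norm_sub y) hf.marks n hm
    simp only [P.lintegral_markPower] at h
    exact h
  have hg : Measurable fun x : Plane =>
      ENNReal.ofReal (∑ z, P.linkProb z ‖x - y‖ * P.meanPower z ‖x - y‖) := by
    have h1 := P.measurable_linkProb
    have h2 := P.measurable_meanPower
    fun_prop
  -- Averaging the marks replaces each power by its mean at the location; Campbell's formula then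
  -- bounds the expected sum.
  have hfinite : ∫⁻ ω, ∑' n, ENNReal.ofReal (receivedPower P y U Z G H n ω) ∂μ ≠ ∞ := by
    rw [lintegral_tsum fun n => (hf.measurable_receivedPower n).ennreal_ofReal.aemeasurable]
    simp_rw [hmean]
    have h := lintegral_tsum (μ := μ) fun n => (hg.comp (hf.poisson.measurable n)).aemeasurable
    simp only [Function.comp_def] at h
    rw [← h, hf.poisson.lintegral_tsum hg]
    exact ENNReal.mul_ne_top ENNReal.ofReal_ne_top
      (P.integrable_linkProb_mul_meanPower y).lintegral_lt_top.ne
  filter_upwards [hf.ae_receivedPower_nonneg, ae_lt_top (Measurable.tsum fun n =>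
    (hf.measurable_receivedPower n).ennreal_ofReal) hfinite] with ω hnn hω
  have := ENNReal.summable_toReal hω.ne
  simpa only [ENNReal.toReal_ofReal (hnn _)] using this

/-- The Laplace transform of the interference, as the Laplace functional of the locations. -/
theorem laplaceTransform_eq_integral [IsProbabilityMeasure μ]
    (hf : IsInterferenceField μ P y U Z G H) {s : ℝ} (hs : 0 ≤ s) :
    laplaceTransform μ (downlinkInterference P y U Z G H) s =
      Real.exp (-(P.lam * ∫ x : Plane,
        (1 - ∑ z, P.linkProb z ‖x - y‖ * P.powerTransform s z ‖x - y‖))) := by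
  set φ : Plane → ℝ := fun x => ∑ z, P.linkProb z ‖x - y‖ * P.powerTransform s z ‖x - y‖
  set mean : Plane → ℝ := fun x => ∑ z, P.linkProb z ‖x - y‖ * P.meanPower z ‖x - y‖
  have hφm : Measurable φ := by
    have h1 := P.measurable_linkProb
    have h2 := P.measurable_powerTransform s
    fun_prop
  -- Jensen once more, now over link types.
  have hexp : ∀ x, Real.exp (-(s * mean x)) ≤ φ x := by
    intro x
    have h := convexOn_exp.map_sum_le (t := Finset.univ) (w := fun z => P.linkProb z ‖x - y‖)
      (p := fun z => -(s * P.meanPower z ‖x - y‖))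
      (fun z _ => P.linkProb_nonneg z _) (P.sum_linkProb _) (fun z _ => Set.mem_univ _)
    simp only [smul_eq_mul] at h
    calc Real.exp (-(s * mean x))
        = Real.exp (∑ z, P.linkProb z ‖x - y‖ * -(s * P.meanPower z ‖x - y‖)) := by
          congr 1
          rw [Finset.mul_sum, ← Finset.sum_neg_distrib]
          exact Finset.sum_congr rfl fun z _ => by ring
      _ ≤ _ := h
      _ ≤ φ x := Finset.sum_le_sum fun z _ => mul_le_mul_of_nonneg_left
          (P.exp_neg_le_powerTransform hs z _) (P.linkProb_nonneg z _)
  have hφpos : ∀ x, 0 < φ x := fun x => (Real.exp_pos _).trans_le (hexp x)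
  have hφone : ∀ x, φ x ≤ 1 := by
    intro x
    rw [← P.sum_linkProb ‖x - y‖]
    exact Finset.sum_le_sum fun z _ => mul_le_of_le_one_right (P.linkProb_nonneg z _)
      (P.powerTransform_le_one hs z _)
  set g : Plane → ℝ≥0∞ := fun x => ENNReal.ofReal (-Real.log (φ x))
  have hgm : Measurable g := hφm.log.neg.ennreal_ofReal
  have hgreal : ∀ x, (g x).toReal = -Real.log (φ x) := fun x =>
    ENNReal.toReal_ofReal (neg_nonneg.2 (Real.log_nonpos (hφpos x).le (hφone x)))
  have hgexp : ∀ x, Real.exp (-(g x).toReal) = φ x := fun x => by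
    rw [hgreal, neg_neg, Real.exp_log (hφpos x)]
  have hgint : ∫⁻ x, g x ≠ ∞ := by
    refine ne_top_of_le_ne_top
      ((P.integrable_linkProb_mul_meanPower y).const_mul s).lintegral_lt_top.ne
      (lintegral_mono fun x => ENNReal.ofReal_le_ofReal ?_)
    have := Real.log_le_log (Real.exp_pos _) (hexp x)
    rw [Real.log_exp] at this
    linarith
  have hgtop : ∀ x, g x ≠ ∞ := fun x => ENNReal.ofReal_ne_top
  -- The mark law concerns finitely many links, so marks are averaged out of partial sums.
  have hpartial : ∀ k : ℕ,
      ∫ ω, Real.exp (-(s * ∑ n ∈ Finset.range k, receivedPower P y U Z G H n ω)) ∂μ =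
        ∫ ω, Real.exp (-∑ n ∈ Finset.range k, (g (U n ω)).toReal) ∂μ := by
    intro k
    have hm : Measurable (Function.uncurry fun (x : Plane) (m : LinkType × ℝ × ℝ) =>
        ENNReal.ofReal (Real.exp (-(s * P.markPower ‖x - y‖ m)))) :=
      ((P.measurable_markPower_norm_sub y).const_mul s).neg.exp.ennreal_ofReal
    have h := lintegral_prod_marks μ hf.poisson.measurable hf.measurable_mark
      (P.measurable_markLaw_norm_sub y) hf.marks k (fun _ => hm)
    simp only [P.lintegral_exp_neg_markPower hs] at h
    have hrm := hf.measurable_receivedPower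
    have hUm := hf.poisson.measurable
    rw [integral_eq_lintegral_of_nonneg_ae (Filter.Eventually.of_forall fun _ =>
        (Real.exp_pos _).le) (by fun_prop : Measurable fun ω => Real.exp
          (-(s * ∑ n ∈ Finset.range k, receivedPower P y U Z G H n ω))).aestronglyMeasurable,
      integral_eq_lintegral_of_nonneg_ae (Filter.Eventually.of_forall fun _ =>
        (Real.exp_pos _).le) (by fun_prop : Measurable fun ω => Real.exp
          (-∑ n ∈ Finset.range k, (g (U n ω)).toReal)).aestronglyMeasurable]
    congr 1
    convert h using 1
    · refine lintegral_congr fun ω => ?_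
      rw [Finset.mul_sum, ← Finset.sum_neg_distrib, Real.exp_sum,
        ENNReal.ofReal_prod_of_nonneg fun _ _ => (Real.exp_pos _).le]
      rfl
    · refine lintegral_congr fun ω => ?_
      rw [← Finset.sum_neg_distrib, Real.exp_sum,
        ENNReal.ofReal_prod_of_nonneg fun _ _ => (Real.exp_pos _).le]
      simp only [hgexp]
      rfl
  -- Stated for general `X` because it serves both sides of `hpartial`; nonnegative summands keep
  -- the exponentials below `1`.
  have hlim : ∀ {X : ℕ → Ω → ℝ}, (∀ n, Measurable (X n)) → (∀ᵐ ω ∂μ, ∀ n, 0 ≤ X n ω) →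
      (∀ᵐ ω ∂μ, Summable fun n => X n ω) →
      Filter.Tendsto (fun k => ∫ ω, Real.exp (-∑ n ∈ Finset.range k, X n ω) ∂μ) Filter.atTop
        (nhds (∫ ω, Real.exp (-∑' n, X n ω) ∂μ)) := by
    intro X hXm hX0 hXs
    refine tendsto_integral_of_dominated_convergence (fun _ => 1) (fun k => ?_)
      (integrable_const _) (fun k => ?_) ?_
    · exact (by fun_prop : Measurable fun ω =>
        Real.exp (-∑ n ∈ Finset.range k, X n ω)).aestronglyMeasurable
    · filter_upwards [hX0] with ω hω
      rw [Real.norm_eq_abs, abs_of_pos (Real.exp_pos _), Real.exp_le_one_iff, neg_nonpos]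
      exact Finset.sum_nonneg fun n _ => hω n
    · filter_upwards [hXs] with ω hω
      exact (Real.continuous_exp.tendsto _).comp
        ((continuous_neg.tendsto _).comp hω.hasSum.tendsto_sum_nat)
  have h1 := hlim (X := fun n ω => s * receivedPower P y U Z G H n ω)
    (fun n => (hf.measurable_receivedPower n).const_mul s)
    (hf.ae_receivedPower_nonneg.mono fun ω hω n => mul_nonneg hs (hω n))
    (hf.ae_summable.mono fun ω hω => hω.mul_left s)
  have h2 := hlim (X := fun n ω => (g (U n ω)).toReal)
    (fun n => (hgm.comp (hf.poisson.measurable n)).ennreal_toReal)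
    (Filter.Eventually.of_forall fun ω n => ENNReal.toReal_nonneg)
    ((hf.poisson.ae_tsum_ne_top hgm hgint).mono fun ω hω => ENNReal.summable_toReal hω)
  simp only [← Finset.mul_sum, tsum_mul_left, hpartial] at h1
  have h := tendsto_nhds_unique h1 h2
  have hL := hf.poisson.laplace_functional P.lam_pos.le hgm hgint hgtop
  simp only [ENNReal.tsum_toReal_eq fun n => hgtop _, hgexp] at hL
  rw [← hL, ← h, laplaceTransform]
  simp only [downlinkInterference, neg_mul]

end IsInterferenceField

/-! ### The product formula -/

theorem lemma1 {Ω : Type*} [MeasurableSpace Ω] (μ : Measure Ω) [IsProbabilityMeasure μ]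
    (P : NetworkParams) (y : Plane) (U : ℕ → Ω → Plane) (Z : ℕ → Ω → LinkType)
    (G H : ℕ → Ω → ℝ) (hfield : IsInterferenceField μ P y U Z G H) :
    (∀ᵐ ω ∂μ, Summable (fun n => receivedPower P y U Z G H n ω)) ∧
    ∀ s : ℝ, 0 ≤ s →
      (∀ z : LinkType, IntegrableOn
        (fun q : ℝ =>
          (1 - ∑ i : Fin 4, P.gainProb i *
            (1 + s * P.Pu * P.gain i * (q ^ 2 + P.h ^ 2) ^ (-(P.α z) / 2) / P.m z) ^ (-(P.m z)))
          * q * P.linkProb z q) (Set.Ioi 0)) ∧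
      laplaceTransform μ (downlinkInterference P y U Z G H) s =
        ∏ z : LinkType, Real.exp (-2 * Real.pi * P.lam *
          ∫ q in Set.Ioi (0 : ℝ),
            (1 - ∑ i : Fin 4, P.gainProb i *
              (1 + s * P.Pu * P.gain i * (q ^ 2 + P.h ^ 2) ^ (-(P.α z) / 2) / P.m z) ^ (-(P.m z)))
            * q * P.linkProb z q) := by
  refine ⟨hfield.ae_summable, fun s hs => ?_⟩
  have hrw : ∀ z, (fun q : ℝ => (1 - ∑ i : Fin 4, P.gainProb i *
      (1 + s * P.Pu * P.gain i * (q ^ 2 + P.h ^ 2) ^ (-(P.α z) / 2) / P.m z) ^ (-(P.m z)))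
        * q * P.linkProb z q) =
      fun q => q * ((1 - P.powerTransform s z q) * P.linkProb z q) := by
    intro z
    funext q
    change (1 - P.powerTransform s z q) * q * P.linkProb z q = _
    ring
  simp only [hrw]
  have hint := P.integrable_one_sub_powerTransform hs
  refine ⟨fun z => integrableOn_mul_of_integrable_fun_norm (hint z), ?_⟩
  rw [hfield.laplaceTransform_eq_integral hs, ← Real.exp_sum]
  congr 1
  -- Writing `1` as the sum of the link probabilities separates the two types.
  have hsplit : ∀ x : Plane,
      1 - ∑ z, P.linkProb z ‖x - y‖ * P.powerTransform s z ‖x - y‖ =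
        ∑ z, (1 - P.powerTransform s z ‖x - y‖) * P.linkProb z ‖x - y‖ := by
    intro x
    simp only [mul_comm (P.linkProb _ _), sub_mul, one_mul, Finset.sum_sub_distrib, P.sum_linkProb]
  simp_rw [hsplit]
  rw [integral_finsetSum _ fun z _ => (hint z).comp_sub_right y, Finset.mul_sum,
    ← Finset.sum_neg_distrib]
  refine Finset.sum_congr rfl fun z _ => ?_
  rw [integral_sub_right_eq_self
    (fun x : Plane => (1 - P.powerTransform s z ‖x‖) * P.linkProb z ‖x‖) y,
    integral_fun_norm_plane fun q => (1 - P.powerTransform s z q) * P.linkProb z q]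
  ring
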